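/- Let $d\in\mathbb N$ and let $\mu_1,\dots,\mu_d$ be Borel probability measures on $\mathbb R^d$. Let $\Pi(\mu_1,\dots,\mu_d)$ be the set of Borel probability measures $\gamma$ on $(\mathbb R^d)^d$ whose $i$-th marginal is $\mu_i$ for every $i$. Consider the problems $$(\mathrm{MK})\quad \sup_{\gamma\in\Pi(\mu_1,\dots,\mu_d)}\int_{(\mathbb R^d)^d}\det(x_1,\dots,x_d)\,d\gamma(x_1,\dots,x_d),$$ $$(\mathrm{MK}_a)\quad \sup_{\gamma\in\Pi(\mu_1,\dots,\mu_d)}\int_{(\mathbb R^d)^d}|\det(x_1,\dots,x_d)|\,d\gamma(x_1,\dots,x_d).$$ Assume that there are exponents $p_1,\dots,p_d\in(1,+\infty)$ such that $$\sum_{i=1}^d\frac1{p_i}=1\quad\text{and}\quad \sum_{i=1}^d\int_{\mathbb R^d}\frac{|x|^{p_i}}{p_i}\,d\mu_i(x)<+\infty,$$ where $|\cdot|$ is the Euclidean norm, and that there are two different indices $i\ne j$ such that $\mu_i$ and $\mu_j$ are both invariant under $x\mapsto -x$. Then $\det$ is integrable with respect to every $\gamma\in\Pi(\mu_1,\dots,\mu_d)$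 (so both problems are well defined), and every solution (that is, every maximizer) $\bar\gamma$ of $(\mathrm{MK})$ satisfies $\det(x_1,\dots,x_d)\ge 0$ for $\bar\gamma$-almost every $(x_1,\dots,x_d)$ and is also a solution of $(\mathrm{MK}_a)$. -/

import Mathlib

open MeasureTheory
open scoped ENNReal

noncomputable section

namespace DetTransport

/-- Euclidean space of dimension `d`. -/
abbrev Vec (d : ℕ) : Type := EuclideanSpace ℝ (Fin d)

/-- The determinant of the `d × d` matrix with columns `x 0, …, x (d - 1)`. -/
def detVec {d : ℕ} (x : Fin d → Vec d) : ℝ :=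
  Matrix.det (Matrix.of fun i j : Fin d => x j i)

/-- The probability measures on `(ℝ^d)^d` whose `i`-th marginal is `μ i` for every `i`. -/
def couplings {d : ℕ} (μ : Fin d → Measure (Vec d)) : Set (Measure (Fin d → Vec d)) :=
  {γ | IsProbabilityMeasure γ ∧ ∀ i, γ.map (fun x => x i) = μ i}

/-- `γ` solves the problem of maximizing `∫ H dγ` among the couplings of `μ`. -/
def IsSolution {d : ℕ} (μ : Fin d → Measure (Vec d)) (H : (Fin d → Vec d) → ℝ)
    (γ : Measure (Fin d → Vec d)) : Prop :=
  γ ∈ couplings μ ∧ ∀ γ' ∈ couplings μ, ∫ x, H x ∂γ' ≤ ∫ x, H x ∂γ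

/-- There are exponents `p i ∈ (1, ∞)` with `∑ 1 / p i = 1` for which
`∑ ∫ |x| ^ (p i) / p i dμ i` is finite. -/
def MomentCondition {d : ℕ} (μ : Fin d → Measure (Vec d)) : Prop :=
  ∃ p : Fin d → ℝ, (∀ i, 1 < p i) ∧ ∑ i, 1 / p i = 1 ∧
    ∑ i, ∫⁻ x, ENNReal.ofReal (‖x‖ ^ (p i) / p i) ∂(μ i) < ∞

/-- A measure on `ℝ^d` that is invariant under `x ↦ -x`. -/
def IsSymmetric {d : ℕ} (ν : Measure (Vec d)) : Prop :=
  ν.map (fun x => -x) = ν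

end DetTransport

end

namespace DetTransport

variable {d : ℕ}

/-! Any coupling `γ` can be turned into one whose `det`-integral equals the `|det|`-integral of `γ`.
Negating both `x i` and `x j` preserves `det` and, by symmetry, the marginals, so averaging `γ` with
its image gives an invariant coupling `σ`. Negating only `x i` where `det < 0` turns `det` into
`|det|`, and invariance of `σ` keeps the `i`-th marginal (`map_flipNeg_mem_couplings`). Hence a
maximizer for `det` satisfies `∫ |det| ≤ ∫ det`, which forces `det ≥ 0` almost everywhere. -/

/-- Changing the sign of the `i`-th vector. -/
def flip (i : Fin d) (x : Fin d → Vec d) : Fin d → Vec d :=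
  Function.update x i (-(x i))

@[simp] lemma flip_self (i : Fin d) (x : Fin d → Vec d) : flip i x i = -(x i) := by
  simp [flip]

@[simp] lemma flip_of_ne {i k : Fin d} (h : k ≠ i) (x : Fin d → Vec d) : flip i x k = x k := by
  simp [flip, h]

lemma measurable_flip (i : Fin d) : Measurable (flip i : (Fin d → Vec d) → Fin d → Vec d) := by
  refine measurable_pi_lambda _ fun k => ?_
  by_cases h : k = i
  · subst h
    simpa only [flip_self, Function.comp_def] using
      measurable_neg.comp (measurable_pi_apply (X := fun _ : Fin d => Vec d) k)
  · simpa [h] using measurable_pi_apply (X := fun _ : Fin d => Vec d) k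

lemma flip_flip (i : Fin d) (x : Fin d → Vec d) : flip i (flip i x) = x := by
  simp [flip]

lemma flip_comm {i j : Fin d} (h : i ≠ j) (x : Fin d → Vec d) :
    flip i (flip j x) = flip j (flip i x) := by
  simp [flip, h, h.symm, Function.update_comm h]

lemma detVec_eq_basis_det (x : Fin d → Vec d) :
    detVec x = (EuclideanSpace.basisFun (Fin d) ℝ).toBasis.det x := by
  rw [Module.Basis.det_apply]
  rfl

lemma detVec_flip (i : Fin d) (x : Fin d → Vec d) : detVec (flip i x) = -detVec x := by
  simp [detVec_eq_basis_det, flip]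

/-- Hadamard's inequality. -/
lemma abs_detVec_le (x : Fin d → Vec d) : |detVec x| ≤ ∏ i, ‖x i‖ := by
  have : Fact (Module.finrank ℝ (Vec d) = d) := ⟨by simp⟩
  let b := EuclideanSpace.basisFun (Fin d) ℝ
  rw [detVec_eq_basis_det, ← b.toBasis.orientation.volumeForm_robust b rfl]
  exact Orientation.abs_volumeForm_apply_le _ x

lemma continuous_detVec : Continuous (detVec : (Fin d → Vec d) → ℝ) := by
  unfold detVec
  refine Continuous.matrix_det (continuous_pi fun i => continuous_pi fun j => ?_)
  simp only [Matrix.of_apply]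
  fun_prop

lemma measurable_detVec : Measurable (detVec : (Fin d → Vec d) → ℝ) :=
  continuous_detVec.measurable

/-- Hadamard's inequality followed by weighted AM-GM for `‖x i‖ ^ p i` with weights `1 / p i`. The
bound is a sum of one-variable functions, so its integral depends only on the marginals. -/
lemma abs_detVec_le_sum {p : Fin d → ℝ} (hp : ∀ i, 1 < p i) (hsum : ∑ i, 1 / p i = 1)
    (x : Fin d → Vec d) : |detVec x| ≤ ∑ i, ‖x i‖ ^ p i / p i := by
  have h := Real.geom_mean_le_arith_mean_weighted Finset.univ (fun i => 1 / p i)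
    (fun i => ‖x i‖ ^ p i) (fun i _ => one_div_nonneg.2 (zero_lt_one.trans (hp i)).le) hsum
    (fun i _ => by positivity)
  refine (abs_detVec_le x).trans (le_trans (le_of_eq ?_) (h.trans (le_of_eq ?_)))
  · refine Finset.prod_congr rfl fun i _ => ?_
    rw [one_div, Real.rpow_rpow_inv (norm_nonneg _) (zero_lt_one.trans (hp i)).ne']
  · exact Finset.sum_congr rfl fun i _ => by ring

lemma integrable_detVec {μ : Fin d → Measure (Vec d)} (hμ : MomentCondition μ)
    {γ : Measure (Fin d → Vec d)} (hγ : γ ∈ couplings μ) : Integrable detVec γ := by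
  obtain ⟨p, hp, hsum, hfin⟩ := hμ
  have hint (i : Fin d) : Integrable (fun x : Fin d → Vec d => ‖x i‖ ^ p i / p i) γ := by
    have hm : Measurable fun y : Vec d => ‖y‖ ^ p i / p i :=
      (measurable_norm.pow_const _).div_const _
    have h : Integrable (fun y : Vec d => ‖y‖ ^ p i / p i) (μ i) := by
      refine (lintegral_ofReal_ne_top_iff_integrable hm.aestronglyMeasurable
        (ae_of_all _ fun y => ?_)).1 ((ENNReal.sum_lt_top.1 hfin) i (Finset.mem_univ i)).ne
      have := zero_lt_one.trans (hp i)
      simp only [Pi.zero_apply]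
      positivity
    rw [← hγ.2 i] at h
    exact h.comp_measurable (measurable_pi_apply i)
  refine (integrable_finsetSum Finset.univ fun i _ => hint i).mono'
    measurable_detVec.aestronglyMeasurable (ae_of_all _ fun x => ?_)
  exact abs_detVec_le_sum hp hsum x

/-- Only the marginals need to be symmetric: the image may differ from `γ`. -/
lemma map_flip_mem_couplings_of_even {μ : Fin d → Measure (Vec d)} {i j : Fin d} (hij : i ≠ j)
    (hi : IsSymmetric (μ i)) (hj : IsSymmetric (μ j))
    {γ : Measure (Fin d → Vec d)} (hγ : γ ∈ couplings μ) :
    γ.map (flip i ∘ flip j) ∈ couplings μ := by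
  have hm : Measurable (flip i ∘ flip j : (Fin d → Vec d) → _) :=
    (measurable_flip i).comp (measurable_flip j)
  have := hγ.1
  refine ⟨Measure.isProbabilityMeasure_map hm.aemeasurable, fun k => ?_⟩
  have hk : Measurable fun x : Fin d → Vec d => x k := measurable_pi_apply k
  have hneg (h : IsSymmetric (μ k)) : γ.map (fun x => -(x k)) = μ k := by
    conv_rhs => rw [← h, ← hγ.2 k]
    rw [Measure.map_map measurable_neg hk]
    rfl
  rw [Measure.map_map hk hm, Function.comp_def]
  rcases eq_or_ne k i with rfl | hki
  · simpa [hij] using hneg hi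
  rcases eq_or_ne k j with rfl | hkj
  · simpa [hki] using hneg hj
  · simpa [hki, hkj] using hγ.2 k

lemma half_sum_mem_couplings {μ : Fin d → Measure (Vec d)} {γ γ' : Measure (Fin d → Vec d)}
    (hγ : γ ∈ couplings μ) (hγ' : γ' ∈ couplings μ) :
    (2⁻¹ : ℝ≥0∞) • (γ + γ') ∈ couplings μ := by
  have := hγ.1
  have := hγ'.1
  refine ⟨⟨?_⟩, fun k => ?_⟩
  · simp only [Measure.smul_apply, Measure.add_apply, measure_univ, smul_eq_mul, one_add_one_eq_two]
    exact ENNReal.inv_mul_cancel (by simp) (by simp)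
  · rw [Measure.map_smul, Measure.map_add _ _ (measurable_pi_apply k), hγ.2 k, hγ'.2 k,
      ← two_smul ℝ≥0∞, smul_smul, ENNReal.inv_mul_cancel (by simp) (by simp), one_smul]

/-- Changing the sign of the `i`-th vector when the determinant is negative. -/
noncomputable def flipNeg (i : Fin d) (x : Fin d → Vec d) : Fin d → Vec d :=
  if detVec x < 0 then flip i x else x

lemma measurableSet_detVec_neg : MeasurableSet {x : Fin d → Vec d | detVec x < 0} :=
  measurable_detVec measurableSet_Iio

lemma measurable_flipNeg (i : Fin d) :
    Measurable (flipNeg i : (Fin d → Vec d) → Fin d → Vec d) :=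
  Measurable.ite measurableSet_detVec_neg (measurable_flip i) measurable_id

lemma detVec_flipNeg (i : Fin d) (x : Fin d → Vec d) : detVec (flipNeg i x) = |detVec x| := by
  unfold flipNeg
  split_ifs with h
  · rw [detVec_flip, abs_of_neg h]
  · rw [abs_of_nonneg (not_lt.1 h)]

/-- Only the `i`-th marginal is at stake. The double flip preserves `γ` and `{det < 0}` and negates
`x i`, so on that set `x i` and `-(x i)` have the same law. -/
lemma map_flipNeg_mem_couplings {μ : Fin d → Measure (Vec d)} {i j : Fin d} (hij : i ≠ j)
    {γ : Measure (Fin d → Vec d)} (hγ : γ ∈ couplings μ)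
    (hinv : MeasurePreserving (flip i ∘ flip j) γ γ) : γ.map (flipNeg i) ∈ couplings μ := by
  have := hγ.1
  refine ⟨Measure.isProbabilityMeasure_map (measurable_flipNeg i).aemeasurable, fun k => ?_⟩
  have hk : Measurable fun x : Fin d → Vec d => x k := measurable_pi_apply k
  rw [Measure.map_map hk (measurable_flipNeg i), ← hγ.2 k]
  rcases eq_or_ne k i with rfl | hki
  · ext B hB
    rw [Measure.map_apply (hk.comp (measurable_flipNeg k)) hB, Measure.map_apply hk hB,
      ← measure_inter_add_sdiff _ measurableSet_detVec_neg,
      ← measure_inter_add_sdiff ((fun x : Fin d → Vec d => x k) ⁻¹' B) measurableSet_detVec_neg]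
    congr 1
    -- On `{det < 0}`, the single and the double flip have the same `i`-th coordinate, and the
    -- double flip preserves `γ`.
    · rw [← hinv.measure_preimage ((hk hB).inter measurableSet_detVec_neg).nullMeasurableSet]
      congr 1
      ext x
      simp only [Set.mem_inter_iff, Set.mem_preimage, Set.mem_ofPred_eq, Function.comp_apply,
        detVec_flip, neg_neg, flip_self, flip_of_ne hij]
      exact and_congr_left fun h => by simp [flipNeg, h]
    · congr 1
      ext x
      exact and_congr_left fun h => by
        rw [Set.mem_ofPred_eq] at h
        simp [flipNeg, h]
  · congr 1
    ext1 x
    by_cases h : detVec x < 0 <;> simp [flipNeg, h, hki]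

/-- If two of the marginals are symmetric, then the value of any coupling for `|det|` is attained
by a coupling for `det`. -/
lemma exists_coupling_integral_detVec_eq {μ : Fin d → Measure (Vec d)} (hμ : MomentCondition μ)
    {i j : Fin d} (hij : i ≠ j) (hi : IsSymmetric (μ i)) (hj : IsSymmetric (μ j))
    {γ : Measure (Fin d → Vec d)} (hγ : γ ∈ couplings μ) :
    ∃ γ' ∈ couplings μ, ∫ x, detVec x ∂γ' = ∫ x, |detVec x| ∂γ := by
  set S : (Fin d → Vec d) → Fin d → Vec d := flip i ∘ flip j with hS
  have hSm : Measurable S := (measurable_flip i).comp (measurable_flip j)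
  have hSS : S ∘ S = id := by
    ext1 x
    simp only [hS, Function.comp_apply, id]
    rw [← flip_comm hij (flip j x), flip_flip, flip_flip]
  have hγS : γ.map S ∈ couplings μ := map_flip_mem_couplings_of_even hij hi hj hγ
  have hσ := half_sum_mem_couplings hγ hγS
  set σ := (2⁻¹ : ℝ≥0∞) • (γ + γ.map S) with hσdef
  have hinv : MeasurePreserving S σ σ := by
    refine ⟨hSm, ?_⟩
    rw [hσdef, Measure.map_smul, Measure.map_add _ _ hSm, Measure.map_map hSm hSm, hSS,
      Measure.map_id, add_comm]
  refine ⟨_, map_flipNeg_mem_couplings hij hσ hinv, ?_⟩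
  have habs : Measurable fun x : Fin d → Vec d => |detVec x| := measurable_detVec.abs
  have hflip : ∫ x, |detVec x| ∂γ.map S = ∫ x, |detVec x| ∂γ := by
    rw [integral_map hSm.aemeasurable habs.aestronglyMeasurable]
    simp [hS, detVec_flip]
  rw [integral_map (measurable_flipNeg i).aemeasurable measurable_detVec.aestronglyMeasurable]
  simp only [detVec_flipNeg]
  rw [hσdef, integral_smul_measure, integral_add_measure (integrable_detVec hμ hγ).abs
    (integrable_detVec hμ hγS).abs, hflip]
  simp only [ENNReal.toReal_inv, ENNReal.toReal_ofNat, smul_eq_mul]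
  ring

end DetTransport

open DetTransport in
theorem mainTheorem8 {d : ℕ} (μ : Fin d → Measure (DetTransport.Vec d))
    (hprob : ∀ i, IsProbabilityMeasure (μ i))
    (hμ : DetTransport.MomentCondition μ)
    (hsymm : ∃ i j : Fin d, i ≠ j ∧
      DetTransport.IsSymmetric (μ i) ∧ DetTransport.IsSymmetric (μ j)) :
    (∀ γ ∈ DetTransport.couplings μ, Integrable DetTransport.detVec γ) ∧
    ∀ γ : Measure (Fin d → DetTransport.Vec d),
      DetTransport.IsSolution μ DetTransport.detVec γ →
        (∀ᵐ x ∂γ, 0 ≤ DetTransport.detVec x) ∧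
        DetTransport.IsSolution μ (fun x => |DetTransport.detVec x|) γ := by
  refine ⟨fun γ hγ => integrable_detVec hμ hγ, fun γ ⟨hγ, hmax⟩ => ?_⟩
  obtain ⟨i, j, hij, hi, hj⟩ := hsymm
  -- Used for all `γ'` to get optimality for `|det|`, and for `γ' = γ` to get the sign of `det`.
  have hle : ∀ γ' ∈ couplings μ, ∫ x, |detVec x| ∂γ' ≤ ∫ x, detVec x ∂γ := fun γ' hγ' => by
    obtain ⟨γ'', hγ'', h⟩ := exists_coupling_integral_detVec_eq hμ hij hi hj hγ'
    exact h ▸ hmax γ'' hγ''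
  have hint := integrable_detVec hμ hγ
  refine ⟨?_, hγ, fun γ' hγ' => (hle γ' hγ').trans
    (integral_mono hint hint.abs fun x => le_abs_self _)⟩
  have hnonneg : 0 ≤ fun x : Fin d → Vec d => |detVec x| - detVec x :=
    fun x => sub_nonneg.2 (le_abs_self _)
  have hzero : ∫ x, (|detVec x| - detVec x) ∂γ = 0 := by
    refine le_antisymm ?_ (integral_nonneg hnonneg)
    rw [integral_sub hint.abs hint]
    exact sub_nonpos.2 (hle γ hγ)
  filter_upwards [(integral_eq_zero_iff_of_nonneg hnonneg (hint.abs.sub hint)).1 hzero] with x hx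
  exact abs_eq_self.1 (sub_eq_zero.1 hx)
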